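/- **Theorem 5.2.** Fix an integer $b\ge 2$. For $n\ge 1$, add $n$ numbers written in base $b$ whose digits $D_{t,i}$ ($t\ge 0$ the column, counted from the right, $1\le i\le n$) are independent and uniform on $\{0,1,\dots,b-1\}$. The carries are $\kappa_0=0$ and $\kappa_{t+1}=\lfloor(\kappa_t+\sum_{i=1}^n D_{t,i})/b\rfloor$. Let $P_n$ be the law on $\mathbb{R}^\infty$ (with the product topology) of the process $$Y_t=\frac{\kappa_t-n/2}{\sqrt{n/12}},\qquad t=0,1,2,\dots.$$ For $x\in\mathbb{R}$ let $Q^{(x)}$ be the law on $\mathbb{R}^\infty$ of the Gaussian autoregressive process $W_0=x$, $W_{t+1}=W_t/b+\epsilon_t$, where the $\epsilon_t$ are independent Normal$(0,1-\frac1{b^2})$ random variables, and put $Q_n=Q^{(-\sqrt{3n})}$. Then, as $n\to\infty$, $P_n$ and $Q_n$ are weakly asymptotically equal, in both of the following senses: 1. $\int F\,dP_n-\int F\,dQ_n\to 0$ for every bounded $F:\mathbb{R}^\infty\to\mathbb{R}$ that is uniformly continuous with respect to the product uniform structure. 2. After the means $-\sqrt{3n}\,b^{-t}$ of $W_t$ under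 $Q_n$ are subtracted, there is weak convergence in the usual sense: the law of the process $\left(Y_t+\sqrt{3n}\,b^{-t}\right)_{t\ge 0}$ converges weakly on $\mathbb{R}^\infty$ to $Q^{(0)}$, which is the law of $\left(W_t+\sqrt{3n}\,b^{-t}\right)_{t\ge 0}$ under $Q_n$ for every $n$. -/

import Mathlib

open Filter Topology MeasureTheory ProbabilityTheory
open scoped BoundedContinuousFunction

noncomputable section

/-- The carries produced by adding `n` numbers written in base `b`, where `d t i` is the digit of
the `i`-th number in column `t` (column `0` is the rightmost one). -/
def carry (b n : ℕ) (d : ℕ → Fin n → Fin b) : ℕ → ℕ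
  | 0 => 0
  | t + 1 => (carry b n d t + ∑ i, (d t i : ℕ)) / b

/-- The law of the digits: all digits are independent and uniform on `{0, …, b - 1}`. -/
def digitMeasure (b n : ℕ) [NeZero b] : Measure (ℕ → Fin n → Fin b) :=
  Measure.infinitePi fun _ : ℕ => Measure.pi fun _ : Fin n =>
    (PMF.uniformOfFintype (Fin b)).toMeasure

instance (b n : ℕ) [NeZero b] : IsProbabilityMeasure (digitMeasure b n) := by
  unfold digitMeasure; infer_instance

/-- The normalized carries process `Y_t = (κ_t - n/2) / √(n/12)`. -/
def normalizedCarry (b n : ℕ) (d : ℕ → Fin n → Fin b) (t : ℕ) : ℝ :=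
  ((carry b n d t : ℝ) - n / 2) / √((n : ℝ) / 12)

lemma measurable_carry (b n t : ℕ) : Measurable fun d : ℕ → Fin n → Fin b => carry b n d t := by
  induction t with
  | zero => exact measurable_const
  | succ t ih =>
    have h : Measurable fun p : ℕ × (Fin n → Fin b) => (p.1 + ∑ i, (p.2 i : ℕ)) / b :=
      measurable_of_countable _
    exact h.comp (ih.prodMk (measurable_pi_apply t))

lemma measurable_normalizedCarry (b n : ℕ) : Measurable (normalizedCarry b n) := by
  refine measurable_pi_lambda _ fun t => ?_
  have h : Measurable fun k : ℕ => ((k : ℝ) - n / 2) / √((n : ℝ) / 12) :=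
    measurable_of_countable _
  exact h.comp (measurable_carry b n t)

/-- The law `P_n` on `ℝ^∞` of the process `Y_0, Y_1, …`. -/
def carriesLaw (b n : ℕ) [NeZero b] : ProbabilityMeasure (ℕ → ℝ) :=
  ⟨(digitMeasure b n).map (normalizedCarry b n),
    Measure.isProbabilityMeasure_map (measurable_normalizedCarry b n).aemeasurable⟩

/-- The autoregressive recursion `W_0 = x`, `W_{t+1} = W_t / b + ε_t`. -/
def autoregression (b : ℕ) (x : ℝ) (ε : ℕ → ℝ) : ℕ → ℝ
  | 0 => x
  | t + 1 => autoregression b x ε t / b + ε t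

/-- The law of the noise: the `ε_t` are independent, each `N(0, 1 - 1/b²)`. -/
def noiseMeasure (b : ℕ) : Measure (ℕ → ℝ) :=
  Measure.infinitePi fun _ : ℕ => gaussianReal 0 (Real.toNNReal (1 - 1 / (b : ℝ) ^ 2))

instance (b : ℕ) : IsProbabilityMeasure (noiseMeasure b) := by
  unfold noiseMeasure; infer_instance

lemma measurable_autoregression (b : ℕ) (x : ℝ) : Measurable (autoregression b x) := by
  refine measurable_pi_lambda _ fun t => ?_
  induction t with
  | zero => exact measurable_const
  | succ t ih => exact (ih.div_const _).add (measurable_pi_apply t)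

/-- The law on `ℝ^∞` of the Gaussian autoregressive process started at `W_0 = x`. -/
def autoregressiveLaw (b : ℕ) (x : ℝ) : ProbabilityMeasure (ℕ → ℝ) :=
  ⟨(noiseMeasure b).map (autoregression b x),
    Measure.isProbabilityMeasure_map (measurable_autoregression b x).aemeasurable⟩

/-- The map of `ℝ^∞` subtracting `x / b ^ t`, the mean at time `t` of the autoregressive process
started at `x`, from the `t`-th coordinate. -/
def recentre (b : ℕ) (x : ℝ) (y : ℕ → ℝ) (t : ℕ) : ℝ :=
  y t - x / (b : ℝ) ^ t

lemma measurable_recentre (b : ℕ) (x : ℝ) : Measurable (recentre b x) :=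
  measurable_pi_lambda _ fun t => (measurable_pi_apply t).sub_const _

end

/-! Since `κ_{t+1} = (κ_t + ∑ D_{t,i} - r_t) / b` with remainder `0 ≤ r_t < b`, the normalized
carries satisfy the autoregressive recursion driven by the column sums, up to a rounding error of at
most `1 / √(n/12)` per step. The factor `1/b` damps earlier errors, so the total stays of order
`1/√n` for every digit array (`abs_normalizedCarry_sub_autoregression_le`).

The column sums are independent and each is asymptotically normal (`tendsto_columnNoiseLaw`), hence
jointly so on `ℝ^∞` (`tendsto_infinitePi`). The recursion from `0` is continuous in the noise, so
continuous mapping and a Slutsky argument (`tendsto_map_of_uniformly_close`) give the second claim.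

For the first claim, undoing the recentring replaces `F` by translates of `F` that vary with `n`.
These are equally bounded and uniformly equicontinuous because `F` is uniformly continuous, and weak
convergence is uniform over such families
(`tendsto_integral_sub_integral_of_uniformEquicontinuous`). -/

/-! ### Weak convergence: countable products, moving test functions, Slutsky -/

section WeakConvergence

/-- The product of a family of probability measures. -/
noncomputable def infiniteProduct {ι : Type*} {α : ι → Type*} [∀ i, MeasurableSpace (α i)]
    (μ : (i : ι) → ProbabilityMeasure (α i)) : ProbabilityMeasure ((i : ι) → α i) :=
  ⟨Measure.infinitePi fun i => (μ i : Measure (α i)), inferInstance⟩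

/-- Weak convergence of the factors implies weak convergence of countable products. -/
theorem tendsto_infinitePi {ι γ : Type*} [Countable ι] {α : ι → Type*}
    [∀ i, PseudoMetricSpace (α i)] [∀ i, SecondCountableTopology (α i)]
    [∀ i, MeasurableSpace (α i)] [∀ i, OpensMeasurableSpace (α i)]
    {l : Filter γ} [l.IsCountablyGenerated]
    {μs : γ → (i : ι) → ProbabilityMeasure (α i)}
    {μ : (i : ι) → ProbabilityMeasure (α i)} (h : ∀ i, Tendsto (fun c => μs c i) l (𝓝 (μ i))) :
    Tendsto (fun c => infiniteProduct (μs c)) l (𝓝 (infiniteProduct μ)) := by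
  classical
  -- Finite-dimensional boxes whose sides are continuity sets of the limit: a π-system containing
  -- arbitrarily small neighbourhoods of each point, on which the measures are finite products.
  let S : Set (Set ((i : ι) → α i)) := {t | ∃ (I : Finset ι) (s : (i : ι) → Set (α i)),
    t = Set.pi I s ∧ (∀ i, MeasurableSet (s i)) ∧ ∀ i, (μ i : Measure (α i)) (frontier (s i)) = 0}
  have hS : IsPiSystem S := by
    rintro - ⟨I, s, rfl, hsm, hs⟩ - ⟨J, t, rfl, htm, ht⟩ -
    refine ⟨I ∪ J, fun i => (if i ∈ I then s i else Set.univ) ∩ (if i ∈ J then t i else Set.univ),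
      ?_, fun i => ?_, fun i => ?_⟩
    · ext x
      simp only [Set.mem_inter_iff, Set.mem_pi, Finset.mem_coe, Finset.mem_union]
      constructor
      · rintro ⟨h₁, h₂⟩ i -
        constructor
        · split_ifs with hi
          exacts [h₁ i hi, trivial]
        · split_ifs with hi
          exacts [h₂ i hi, trivial]
      · intro hx
        exact ⟨fun i hi => by simpa [hi] using (hx i (Or.inl hi)).1,
          fun i hi => by simpa [hi] using (hx i (Or.inr hi)).2⟩
    · refine MeasurableSet.inter ?_ ?_ <;> split_ifs <;> simp [hsm, htm]
    · apply null_frontier_inter <;> split_ifs <;> simp [hs, ht]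
  apply hS.tendsto_probabilityMeasure_of_tendsto_of_mem
  · rintro - ⟨I, s, rfl, hsm, -⟩
    exact MeasurableSet.pi I.countable_toSet fun i _ => hsm i
  · intro u hu x hx
    obtain ⟨I, v, hv, hvu⟩ := isOpen_pi_iff.1 hu x hx
    have hr : ∀ i, ∃ r : ℝ, 0 < r ∧ (i ∈ I → Metric.ball (x i) r ⊆ v i) ∧
        (μ i : Measure (α i)) (frontier (Metric.ball (x i) r)) = 0 := by
      intro i
      obtain ⟨ε, hε, hεv⟩ : ∃ ε > 0, i ∈ I → Metric.ball (x i) ε ⊆ v i := by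
        by_cases hi : i ∈ I
        · obtain ⟨ε, hε, h⟩ := Metric.isOpen_iff.1 (hv i hi).1 (x i) (hv i hi).2
          exact ⟨ε, hε, fun _ => h⟩
        · exact ⟨1, one_pos, fun h => absurd h hi⟩
      obtain ⟨r, hr, hr0⟩ := exists_null_frontier_thickening (μ i : Measure (α i)) {x i} hε
      exact ⟨r, hr.1, fun hi => (Metric.ball_subset_ball hr.2.le).trans (hεv hi),
        by simpa using hr0⟩
    choose r hr hrv hr0 using hr
    refine ⟨Set.pi I fun i => Metric.ball (x i) (r i), ⟨I, fun i => Metric.ball (x i) (r i), rfl,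
      fun i => measurableSet_ball, hr0⟩, ?_, ?_⟩
    · exact (isOpen_set_pi I.finite_toSet fun _ _ => Metric.isOpen_ball).mem_nhds
        fun i _ => Metric.mem_ball_self (hr i)
    · exact (Set.pi_mono fun i hi => hrv i hi).trans hvu
  · rintro - ⟨I, s, rfl, hsm, hs⟩
    have key : ∀ ν : (i : ι) → ProbabilityMeasure (α i),
        infiniteProduct ν (Set.pi I s) = ∏ i ∈ I, ν i (s i) := by
      intro ν
      rw [← ENNReal.coe_inj, ProbabilityMeasure.ennreal_coeFn_eq_coeFn_toMeasure]
      change Measure.infinitePi (fun i => (ν i : Measure (α i))) _ = _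
      rw [Measure.infinitePi_pi _ fun i _ => hsm i]
      simp
    simp only [key]
    refine tendsto_finsetProd _ fun i _ => ?_
    exact ProbabilityMeasure.tendsto_measure_of_null_frontier_of_tendsto (h i) (by simpa using hs i)

variable {Ω : Type*} [MeasurableSpace Ω]

/-- If `μ` and `ν` are close in the Lévy–Prokhorov distance and `f` is nonnegative, then `∫ f dμ`
exceeds `∫ f dν` by little, in terms of a modulus of continuity of `f`. -/
lemma integral_le_add_of_levyProkhorovEDist_lt [PseudoMetricSpace Ω] [OpensMeasurableSpace Ω]
    {μ ν : Measure Ω} [IsProbabilityMeasure μ] [IsProbabilityMeasure ν] {δ η : ℝ} (hδ : 0 < δ)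
    (hη : 0 ≤ η) (h : levyProkhorovEDist μ ν < ENNReal.ofReal δ) (f : Ω →ᵇ ℝ) (hf0 : ∀ x, 0 ≤ f x)
    (hf : ∀ x y, dist x y < δ → |f x - f y| ≤ η) :
    ∫ x, f x ∂μ ≤ ∫ x, f x ∂ν + η + δ * ‖f‖ := by
  refine (f.integral_le_of_levyProkhorovEDist_lt μ ν hδ h (ae_of_all _ hf0)).trans ?_
  have hg : ∀ x, 0 ≤ (f + BoundedContinuousFunction.const Ω η) x := fun x =>
    add_nonneg (hf0 x) hη
  have hn : ‖f‖ ≤ ‖f + BoundedContinuousFunction.const Ω η‖ := by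
    refine (BoundedContinuousFunction.norm_le (norm_nonneg _)).2 fun x => ?_
    refine le_trans ?_ ((f + BoundedContinuousFunction.const Ω η).norm_coe_le_norm x)
    rw [Real.norm_of_nonneg (hf0 x), Real.norm_of_nonneg (hg x)]
    simpa using hη
  have hint : ∫ x, (f + BoundedContinuousFunction.const Ω η) x ∂ν = ∫ x, f x ∂ν + η := by
    simp [integral_add (f.integrable ν) (integrable_const η)]
  have hanti : ∀ (g : ℝ → Set Ω), Antitone g → ∀ M : ℝ,
      IntegrableOn (fun t => ν.real (g t)) (Set.Ioc 0 M) := fun g hg M =>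
    (AntitoneOn.integrableOn_isCompact isCompact_Icc fun a _ b _ hab =>
      measureReal_mono (hg hab)).mono_set Set.Ioc_subset_Icc_self
  have h1 : Antitone fun t : ℝ => Metric.thickening δ {a | t ≤ f a} := fun s t hst =>
    Metric.thickening_subset_of_subset _ fun a ha => hst.trans ha
  have h2 : Antitone fun t : ℝ => {a | t ≤ (f + BoundedContinuousFunction.const Ω η) a} :=
    fun s t hst a ha => hst.trans ha
  -- The Lévy–Prokhorov bound thickens superlevel sets by `δ`; the modulus of continuity absorbs
  -- this by raising `f` by `η`.
  have hsub : ∀ t, Metric.thickening δ {a | t ≤ f a} ⊆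
      {a | t ≤ (f + BoundedContinuousFunction.const Ω η) a} := by
    intro t x hx
    obtain ⟨y, hy, hxy⟩ := Metric.mem_thickening_iff.1 hx
    have := (abs_le.1 (hf x y hxy)).1
    simp only [Set.mem_ofPred_eq, BoundedContinuousFunction.coe_add, Pi.add_apply,
      BoundedContinuousFunction.const_apply] at hy ⊢
    linarith
  rw [← hint, BoundedContinuousFunction.integral_eq_integral_meas_le _ ν (ae_of_all _ hg)]
  gcongr
  refine (setIntegral_mono (hanti _ h1 _) (hanti _ h2 _) fun t => measureReal_mono (hsub t)).trans ?_
  exact setIntegral_mono_set (hanti _ h2 _) (ae_of_all _ fun _ => measureReal_nonneg)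
    (Set.Ioc_subset_Ioc_right hn).eventuallyLE

lemma abs_integral_sub_le_of_levyProkhorovEDist_lt [PseudoMetricSpace Ω] [OpensMeasurableSpace Ω]
    {μ ν : Measure Ω} [IsProbabilityMeasure μ] [IsProbabilityMeasure ν] {δ η : ℝ} (hδ : 0 < δ)
    (hη : 0 ≤ η) (h : levyProkhorovEDist μ ν < ENNReal.ofReal δ) (f : Ω →ᵇ ℝ)
    (hf : ∀ x y, dist x y < δ → |f x - f y| ≤ η) :
    |∫ x, f x ∂μ - ∫ x, f x ∂ν| ≤ η + δ * (2 * ‖f‖) := by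
  -- The shift makes `f` nonnegative at the price of doubling the norm bound, whence the factor `2`.
  set g : Ω →ᵇ ℝ := f + BoundedContinuousFunction.const Ω ‖f‖ with hg
  have hg0 : ∀ x, 0 ≤ g x := fun x => by
    have := (abs_le.1 (f.norm_coe_le_norm x)).1
    simp only [hg, BoundedContinuousFunction.coe_add, Pi.add_apply,
      BoundedContinuousFunction.const_apply]
    linarith
  have hgn : ‖g‖ ≤ 2 * ‖f‖ := by
    refine (norm_add_le _ _).trans ?_
    have := BoundedContinuousFunction.norm_const_le (α := Ω) ‖f‖
    rw [norm_norm] at this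
    linarith
  have hgf : ∀ x y, dist x y < δ → |g x - g y| ≤ η := fun x y hxy => by simpa [hg] using hf x y hxy
  have hgi : ∀ (ρ : Measure Ω) [IsProbabilityMeasure ρ], ∫ x, g x ∂ρ = ∫ x, f x ∂ρ + ‖f‖ := by
    intro ρ _
    simp [hg, integral_add (f.integrable ρ) (integrable_const ‖f‖)]
  have h1 := integral_le_add_of_levyProkhorovEDist_lt hδ hη h g hg0 hgf
  rw [levyProkhorovEDist_comm] at h
  have h2 := integral_le_add_of_levyProkhorovEDist_lt hδ hη h g hg0 hgf
  have := mul_le_mul_of_nonneg_left hgn hδ.le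
  rw [hgi, hgi] at h1 h2
  exact abs_le.2 ⟨by linarith, by linarith⟩

/-- Weak convergence is uniform over uniformly bounded, uniformly equicontinuous families. -/
theorem tendsto_integral_sub_integral_of_uniformEquicontinuous [UniformSpace Ω]
    [IsCountablyGenerated (uniformity Ω)] [TopologicalSpace.SeparableSpace Ω]
    [OpensMeasurableSpace Ω] {μs : ℕ → ProbabilityMeasure Ω} {μ : ProbabilityMeasure Ω}
    (h : Tendsto μs atTop (𝓝 μ)) {f : ℕ → Ω →ᵇ ℝ} {C : ℝ} (hC : ∀ n, ‖f n‖ ≤ C)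
    (hf : UniformEquicontinuous fun n x => f n x) :
    Tendsto (fun n => ∫ x, f n x ∂(μs n : Measure Ω) - ∫ x, f n x ∂(μ : Measure Ω)) atTop
      (𝓝 0) := by
  obtain ⟨m, hm⟩ : ∃ m : PseudoMetricSpace Ω, m.toUniformSpace = ‹UniformSpace Ω› :=
    ⟨UniformSpace.pseudoMetricSpace Ω, rfl⟩
  subst hm
  have hC0 : 0 ≤ C := (norm_nonneg _).trans (hC 0)
  rw [Metric.tendsto_nhds]
  intro ε hε
  obtain ⟨δ₀, hδ₀, hfδ⟩ := Metric.uniformEquicontinuous_iff.1 hf (ε / 2) (by positivity)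
  -- The total error is then at most `ε/2 + ε/4`; `C + 1` avoids division by zero.
  set δ := min δ₀ (ε / (8 * (C + 1)))
  have hδ : 0 < δ := by positivity
  have hLP := (LevyProkhorov.continuous_ofMeasure_probabilityMeasure (Ω := Ω)).tendsto μ |>.comp h
  rw [Metric.tendsto_nhds] at hLP
  filter_upwards [hLP δ hδ] with n hn
  have hn' : levyProkhorovEDist (μs n : Measure Ω) μ < ENNReal.ofReal δ := by
    rw [← ENNReal.ofReal_toReal (levyProkhorovEDist_ne_top _ _)]
    exact (ENNReal.ofReal_lt_ofReal_iff hδ).2 hn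
  have := abs_integral_sub_le_of_levyProkhorovEDist_lt hδ (η := ε / 2) (by positivity) hn' (f n)
    fun x y hxy => (hfδ x y (hxy.trans_le (min_le_left _ _)) n).le
  rw [Real.dist_eq, sub_zero]
  refine this.trans_lt ?_
  have h1 : δ * (2 * ‖f n‖) ≤ ε / (8 * (C + 1)) * (2 * (C + 1)) := by
    gcongr
    · exact min_le_right _ _
    · linarith [hC n]
  have h2 : ε / (8 * (C + 1)) * (2 * (C + 1)) = ε / 4 := by field_simp; norm_num
  linarith

/-- A form of Slutsky's theorem in which the probability space is allowed to vary: random elements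
that are uniformly close have the same limit in law. -/
theorem tendsto_map_of_uniformly_close [UniformSpace Ω] [IsCountablyGenerated (uniformity Ω)]
    [OpensMeasurableSpace Ω] {A : ℕ → Type*} [∀ n, MeasurableSpace (A n)]
    {ρ : (n : ℕ) → ProbabilityMeasure (A n)} {X Y : (n : ℕ) → A n → Ω}
    (hX : ∀ n, Measurable (X n)) (hY : ∀ n, Measurable (Y n)) {μ : ProbabilityMeasure Ω}
    (h : Tendsto (fun n => (ρ n).map (hX n).aemeasurable) atTop (𝓝 μ))
    (hXY : ∀ U ∈ uniformity Ω, ∀ᶠ n in atTop, ∀ a, (X n a, Y n a) ∈ U) :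
    Tendsto (fun n => (ρ n).map (hY n).aemeasurable) atTop (𝓝 μ) := by
  obtain ⟨m, hm⟩ : ∃ m : PseudoMetricSpace Ω, m.toUniformSpace = ‹UniformSpace Ω› :=
    ⟨UniformSpace.pseudoMetricSpace Ω, rfl⟩
  subst hm
  rw [tendsto_iff_forall_lipschitz_integral_tendsto] at h ⊢
  rintro f hfb ⟨L, hfL⟩
  refine (tendsto_iff_of_dist ?_).1 (h f hfb ⟨L, hfL⟩)
  have hm : ∀ (n : ℕ) (Z : A n → Ω) (hZ : Measurable Z),
      ∫ x, f x ∂(((ρ n).map hZ.aemeasurable : ProbabilityMeasure Ω) : Measure Ω) =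
        ∫ a, f (Z a) ∂(ρ n : Measure (A n)) := fun n Z hZ => by
    rw [ProbabilityMeasure.toMeasure_map,
      integral_map hZ.aemeasurable hfL.continuous.measurable.aestronglyMeasurable]
  have hi : ∀ (n : ℕ) (Z : A n → Ω) (hZ : Measurable Z),
      Integrable (fun a => f (Z a)) (ρ n : Measure (A n)) := fun n Z hZ => by
    let g : Ω →ᵇ ℝ := ⟨⟨f, hfL.continuous⟩, hfb⟩
    have := Measure.isProbabilityMeasure_map (μ := (ρ n : Measure (A n))) hZ.aemeasurable
    exact (g.integrable ((ρ n : Measure (A n)).map Z)).comp_measurable hZ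
  rw [Metric.tendsto_nhds]
  intro ε hε
  obtain ⟨δ, hδ, hfδ⟩ := Metric.uniformContinuous_iff.1 hfL.uniformContinuous (ε / 2)
    (by positivity)
  filter_upwards [hXY _ (Metric.dist_mem_uniformity hδ)] with n hn
  rw [hm n _ (hX n), hm n _ (hY n), Real.dist_eq, sub_zero, abs_of_nonneg dist_nonneg,
    Real.dist_eq, ← integral_sub (hi n _ (hX n)) (hi n _ (hY n))]
  refine lt_of_le_of_lt ?_ (half_lt_self hε)
  have := norm_integral_le_of_norm_le_const (μ := (ρ n : Measure (A n)))
    (f := fun a => f (X n a) - f (Y n a)) (C := ε / 2)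
    (ae_of_all _ fun a => by simpa [Real.dist_eq] using (hfδ (hn a)).le)
  simpa using this

end WeakConvergence

/-! ### The central limit theorem for one column -/

section ColumnNoise

/-- The normalized and centred sum of the digits of one column. -/
noncomputable def columnNoise (b n : ℕ) (c : Fin n → Fin b) : ℝ :=
  (∑ i, ((c i : ℕ) : ℝ) - n * (b - 1) / 2) / (b * √((n : ℝ) / 12))

lemma measurable_columnNoise (b n : ℕ) : Measurable (columnNoise b n) :=
  measurable_of_countable _

/-- The law of the normalized and centred sum of the digits of one column. -/
noncomputable def columnNoiseLaw (b n : ℕ) [NeZero b] : ProbabilityMeasure ℝ :=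
  ⟨(Measure.pi fun _ : Fin n => (PMF.uniformOfFintype (Fin b)).toMeasure).map (columnNoise b n),
    Measure.isProbabilityMeasure_map (measurable_columnNoise b n).aemeasurable⟩

lemma sum_fin_sub_mean (b : ℕ) : ∑ i : Fin b, (((i : ℕ) : ℝ) - ((b : ℝ) - 1) / 2) = 0 := by
  have h : ∀ m : ℕ, ∑ i ∈ Finset.range m, (i : ℝ) = m * (m - 1) / 2 := by
    intro m
    induction m with
    | zero => simp
    | succ m ih => rw [Finset.sum_range_succ, ih]; push_cast; ring
  rw [Finset.sum_sub_distrib, Fin.sum_univ_eq_sum_range (fun i => (i : ℝ)), h]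
  simp
  ring

lemma sum_fin_sub_mean_sq (b : ℕ) :
    ∑ i : Fin b, (((i : ℕ) : ℝ) - ((b : ℝ) - 1) / 2) ^ 2 = b * ((b : ℝ) ^ 2 - 1) / 12 := by
  have h : ∀ (a : ℝ) (m : ℕ), ∑ i ∈ Finset.range m, ((i : ℝ) - a) ^ 2 =
      m * (m - 1) * (2 * m - 1) / 6 - a * (m * (m - 1)) + m * a ^ 2 := by
    intro a m
    induction m with
    | zero => simp
    | succ m ih => rw [Finset.sum_range_succ, ih]; push_cast; ring
  rw [Fin.sum_univ_eq_sum_range (fun i => ((i : ℝ) - ((b : ℝ) - 1) / 2) ^ 2), h]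
  ring

lemma integral_uniformOfFintype {α : Type*} [Fintype α] [Nonempty α] [MeasurableSpace α]
    [MeasurableSingletonClass α] (f : α → ℝ) :
    ∫ a, f a ∂(PMF.uniformOfFintype α).toMeasure = (∑ a, f a) / Fintype.card α := by
  rw [PMF.integral_eq_sum]
  simp [Finset.mul_sum, div_eq_inv_mul]

/-- The central limit theorem for the sum of the digits of one column. -/
theorem tendsto_columnNoiseLaw (b : ℕ) [NeZero b] :
    Tendsto (fun n => columnNoiseLaw b n) atTop
      (𝓝 (⟨gaussianReal 0 (Real.toNNReal (1 - 1 / (b : ℝ) ^ 2)), inferInstance⟩ :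
        ProbabilityMeasure ℝ)) := by
  have hb : (b : ℝ) ≠ 0 := NeZero.ne _
  let u : Measure (Fin b) := (PMF.uniformOfFintype (Fin b)).toMeasure
  let P : Measure (ℕ → Fin b) := Measure.infinitePi fun _ => u
  -- With this scaling `n^{-1/2} ∑ g(D_i)` is exactly `columnNoise`; a digit has variance `(b² -
  -- 1)/12`, so `g` has variance `1 - 1/b²`.
  let g : Fin b → ℝ := fun j => √12 / b * (((j : ℕ) : ℝ) - ((b : ℝ) - 1) / 2)
  have hg : Measurable g := measurable_of_countable _
  let X : ℕ → (ℕ → Fin b) → ℝ := fun i ω => g (ω i)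
  have hXm : ∀ i, Measurable (X i) := fun i => hg.comp (measurable_pi_apply i)
  have hmap : ∀ i, P.map (fun ω => ω i) = u := fun i => Measure.infinitePi_map_eval _ i
  have hint : ∀ f : Fin b → ℝ, ∫ ω, f (ω 0) ∂P = (∑ a, f a) / b := by
    intro f
    rw [← integral_map (φ := fun ω : ℕ → Fin b => ω 0) (f := f)
      (measurable_pi_apply 0).aemeasurable (measurable_of_countable _).aestronglyMeasurable,
      hmap, integral_uniformOfFintype]
    simp
  have hmean : ∫ ω, X 0 ω ∂P = 0 := by
    rw [hint g, ← Finset.mul_sum, sum_fin_sub_mean]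
    simp
  have hvar : variance (X 0) P = 1 - 1 / (b : ℝ) ^ 2 := by
    rw [variance_of_integral_eq_zero (hXm 0).aemeasurable hmean]
    have := hint fun a => g a ^ 2
    refine this.trans ?_
    simp only [g, mul_pow, ← Finset.mul_sum, sum_fin_sub_mean_sq]
    rw [div_pow, Real.sq_sqrt (by norm_num)]
    field_simp
  have hindep : iIndepFun X P := iIndepFun_infinitePi fun _ => hg
  have hident : ∀ i, IdentDistrib (X i) (X 0) P P := fun i =>
    ⟨(hXm i).aemeasurable, (hXm 0).aemeasurable, by
      have h : ∀ i, P.map (X i) = u.map g := fun i => by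
        rw [← hmap i, Measure.map_map hg (measurable_pi_apply i)]; rfl
      rw [h, h]⟩
  have hL2 : MemLp (X 0) 2 P := by
    refine MemLp.of_bound (hXm 0).aestronglyMeasurable (∑ a, ‖g a‖) (ae_of_all _ fun ω => ?_)
    exact Finset.single_le_sum (f := fun a => ‖g a‖) (fun _ _ => norm_nonneg _)
      (Finset.mem_univ (ω 0))
  have hclt := tendstoInDistribution_inv_sqrt_mul_sum_sub
    (Y := (id : ℝ → ℝ)) (P' := gaussianReal 0 (variance (X 0) P).toNNReal) HasLaw.id hL2 hindep
    hident
  have hlim : (⟨(gaussianReal 0 (variance (X 0) P).toNNReal).map id,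
        Measure.isProbabilityMeasure_map aemeasurable_id⟩ : ProbabilityMeasure ℝ) =
      ⟨gaussianReal 0 (Real.toNNReal (1 - 1 / (b : ℝ) ^ 2)), inferInstance⟩ := by
    refine Subtype.ext ?_
    change Measure.map id _ = _
    rw [Measure.map_id, hvar]
  rw [← hlim]
  refine Tendsto.congr' ?_ hclt.tendsto
  filter_upwards [eventually_gt_atTop 0] with n hn
  refine Subtype.ext ?_
  change Measure.map _ P = Measure.map (columnNoise b n) _
  -- The central limit theorem concerns one infinite sequence; its first `n` terms have the law of a
  -- column.
  have hres : (Measure.pi fun _ : Fin n => u) = P.map fun ω (i : Fin n) => ω i := by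
    rw [← Measure.infinitePi_eq_pi]
    exact (Measure.map_infinitePi_infinitePi_of_inj (P := fun _ : ℕ => u)
      Fin.val_injective).symm
  rw [hres, Measure.map_map (measurable_columnNoise b n) (by fun_prop)]
  congr 1
  ext ω
  have hn' : (0 : ℝ) < n := by exact_mod_cast hn
  have h12 : √((12 : ℝ)) ≠ 0 := by positivity
  have hsn : √(n : ℝ) ≠ 0 := by positivity
  simp only [hmean, mul_zero, sub_zero, Function.comp_apply, columnNoise, X, g]
  rw [Fin.sum_univ_eq_sum_range (fun i => ((ω i : ℕ) : ℝ)), ← Finset.mul_sum,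
    Finset.sum_sub_distrib, Real.sqrt_div hn'.le]
  simp only [Finset.sum_const, Finset.card_range, nsmul_eq_mul]
  field_simp

end ColumnNoise

/-! ### Carries as a perturbed autoregression, and recentring -/

section Carries

lemma autoregression_eq_add (b : ℕ) (x : ℝ) (ε : ℕ → ℝ) (t : ℕ) :
    autoregression b x ε t = autoregression b 0 ε t + x / (b : ℝ) ^ t := by
  induction t with
  | zero => simp [autoregression]
  | succ t ih => simp only [autoregression]; rw [ih, pow_succ, ← div_div]; ring

lemma recentre_autoregression (b : ℕ) (x : ℝ) (ε : ℕ → ℝ) :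
    recentre b x (autoregression b x ε) = autoregression b 0 ε := by
  ext t
  rw [recentre, autoregression_eq_add, add_sub_cancel_right]

lemma continuous_autoregression (b : ℕ) (x : ℝ) : Continuous (autoregression b x) := by
  refine continuous_pi fun t => ?_
  induction t with
  | zero => exact continuous_const
  | succ t ih => exact (ih.div_const _).add (continuous_apply t)

/-- Up to an error of order `1 / √n` due to rounding, the normalized carries are the
autoregressive process driven by the column noises. -/
lemma abs_normalizedCarry_sub_autoregression_le {b n : ℕ} (hb : 2 ≤ b) (hn : 0 < n)
    (d : ℕ → Fin n → Fin b) (t : ℕ) :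
    |normalizedCarry b n d t -
      autoregression b (-√(3 * (n : ℝ))) (fun s => columnNoise b n (d s)) t| ≤
        2 / √((n : ℝ) / 12) := by
  have hn' : (0 : ℝ) < n := by exact_mod_cast hn
  have hb' : (2 : ℝ) ≤ b := by exact_mod_cast hb
  set σ := √((n : ℝ) / 12) with hσ
  have hσ0 : 0 < σ := by positivity
  have hσ2 : σ ^ 2 = n / 12 := Real.sq_sqrt (by positivity)
  -- Rounding down always lowers the carry, so the error is one-sided. The bound `2 / σ` is
  -- preserved by `e ↦ e / b + 1 / σ` because `b ≥ 2`.
  suffices h : 0 ≤ autoregression b (-√(3 * (n : ℝ))) (fun s => columnNoise b n (d s)) t -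
      normalizedCarry b n d t ∧
      autoregression b (-√(3 * (n : ℝ))) (fun s => columnNoise b n (d s)) t -
      normalizedCarry b n d t ≤ 2 / σ by
    rw [abs_sub_comm, abs_of_nonneg h.1]
    exact h.2
  induction t with
  | zero =>
    have h3 : √(3 * (n : ℝ)) = 6 * σ := by
      rw [Real.sqrt_eq_iff_eq_sq (by positivity) (by positivity), mul_pow, hσ2]
      ring
    have : autoregression b (-√(3 * (n : ℝ))) (fun s => columnNoise b n (d s)) 0 -
        normalizedCarry b n d 0 = 0 := by
      simp only [autoregression, normalizedCarry, carry, ← hσ]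
      rw [h3]
      field_simp
      rw [hσ2]
      push_cast
      ring
    rw [this]
    exact ⟨le_rfl, by positivity⟩
  | succ t ih =>
    set A := autoregression b (-√(3 * (n : ℝ))) (fun s => columnNoise b n (d s)) t
    set m := carry b n d t + ∑ i, (d t i : ℕ) with hm
    have hdiv : (m : ℝ) = b * ((m / b : ℕ) : ℝ) + ((m % b : ℕ) : ℝ) := by
      exact_mod_cast (Nat.div_add_mod m b).symm
    have hmod : ((m % b : ℕ) : ℝ) ≤ b := by
      exact_mod_cast (Nat.mod_lt m (by omega)).le
    have hstep : autoregression b (-√(3 * (n : ℝ))) (fun s => columnNoise b n (d s)) (t + 1) -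
        normalizedCarry b n d (t + 1) =
        (A - normalizedCarry b n d t) / b + ((m % b : ℕ) : ℝ) / (b * σ) := by
      have hm' : (m : ℝ) = carry b n d t + ∑ i, ((d t i : ℕ) : ℝ) := by rw [hm]; push_cast; rfl
      have hq : ((m / b : ℕ) : ℝ) = (carry b n d t + ∑ i, ((d t i : ℕ) : ℝ) -
          ((m % b : ℕ) : ℝ)) / b := by
        rw [← hm', eq_div_iff (by positivity)]
        linarith
      change A / b + columnNoise b n (d t) - (((m / b : ℕ) : ℝ) - n / 2) / σ = _
      rw [hq, columnNoise, normalizedCarry, ← hσ]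
      field_simp
      ring
    have hfrac : ((m % b : ℕ) : ℝ) / (b * σ) ≤ 1 / σ := by
      rw [div_le_div_iff₀ (by positivity) hσ0, one_mul]
      gcongr
    have hhalf : (A - normalizedCarry b n d t) / b ≤ 1 / σ := by
      rw [div_le_iff₀ (by positivity)]
      refine ih.2.trans ?_
      rw [div_mul_eq_mul_div, one_mul]
      gcongr
    rw [hstep]
    refine ⟨add_nonneg (div_nonneg ih.1 (by positivity)) (by positivity), ?_⟩
    calc _ ≤ 1 / σ + 1 / σ := add_le_add hhalf hfrac
      _ = 2 / σ := by ring

lemma map_digitMeasure_columnNoise (b n : ℕ) [NeZero b] :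
    (digitMeasure b n).map (fun d t => columnNoise b n (d t)) =
      (infiniteProduct fun _ : ℕ => columnNoiseLaw b n : ProbabilityMeasure (ℕ → ℝ)) :=
  Measure.infinitePi_map_pi _ fun _ => measurable_columnNoise b n

/-- The recentred normalized carries converge in law to the autoregressive process started at
`0`. -/
theorem tendsto_map_recentre_carriesLaw (b : ℕ) [NeZero b] (hb : 2 ≤ b) :
    Tendsto (fun n : ℕ =>
        (carriesLaw b n).map (f := recentre b (-√(3 * (n : ℝ))))
          (measurable_recentre b (-√(3 * (n : ℝ)))).aemeasurable)
      atTop (𝓝 (autoregressiveLaw b 0)) := by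
  have hnoise := tendsto_infinitePi fun _ : ℕ => tendsto_columnNoiseLaw b
  have hX : ∀ n, Measurable fun d : ℕ → Fin n → Fin b =>
      autoregression b 0 fun t => columnNoise b n (d t) := fun n =>
    (measurable_autoregression b 0).comp
      (measurable_pi_lambda _ fun t => (measurable_columnNoise b n).comp (measurable_pi_apply t))
  have hY : ∀ n : ℕ, Measurable fun d : ℕ → Fin n → Fin b =>
      recentre b (-√(3 * (n : ℝ))) (normalizedCarry b n d) := fun n =>
    (measurable_recentre b _).comp (measurable_normalizedCarry b n)
  let ρ : (n : ℕ) → ProbabilityMeasure (ℕ → Fin n → Fin b) := fun n =>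
    ⟨digitMeasure b n, inferInstance⟩
  have hXlim : Tendsto (fun n => (ρ n).map (hX n).aemeasurable) atTop
      (𝓝 (autoregressiveLaw b 0)) := by
    refine (ProbabilityMeasure.tendsto_map_of_tendsto_of_continuous _ _ hnoise
      (continuous_autoregression b 0)).congr fun n => Subtype.ext ?_
    change Measure.map _ (infiniteProduct _ : ProbabilityMeasure (ℕ → ℝ)).toMeasure =
      Measure.map _ (digitMeasure b n)
    rw [← map_digitMeasure_columnNoise]
    exact Measure.map_map (measurable_autoregression b 0)
      (measurable_pi_lambda _ fun t => (measurable_columnNoise b n).comp (measurable_pi_apply t))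
  refine (tendsto_map_of_uniformly_close hX hY hXlim fun U hU => ?_).congr fun n => Subtype.ext ?_
  · have hlim : Tendsto (fun n : ℕ => 2 / √((n : ℝ) / 12)) atTop (𝓝 0) :=
      Tendsto.const_div_atTop (Real.tendsto_sqrt_atTop.comp
        (tendsto_natCast_atTop_atTop.atTop_div_const (by norm_num))) 2
    -- Convergence along `comap Sigma.fst atTop` encodes uniformity over all digit arrays `d`, and
    -- reduces to single coordinates by the product uniformity.
    have hT : Tendsto (fun p : (n : ℕ) × (ℕ → Fin n → Fin b) =>
        (autoregression b 0 fun t => columnNoise b p.1 (p.2 t),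
          recentre b (-√(3 * (p.1 : ℝ))) (normalizedCarry b p.1 p.2)))
        (comap Sigma.fst atTop) (uniformity (ℕ → ℝ)) := by
      rw [Pi.uniformity, tendsto_iInf]
      intro t
      rw [tendsto_comap_iff, Metric.uniformity_eq_comap_nhds_zero, tendsto_comap_iff]
      have hfst : Tendsto (Sigma.fst : ((n : ℕ) × (ℕ → Fin n → Fin b)) → ℕ)
          (comap Sigma.fst atTop) atTop := tendsto_comap
      refine squeeze_zero' (Eventually.of_forall fun _ => dist_nonneg) ?_ (hlim.comp hfst)
      filter_upwards [hfst.eventually (eventually_gt_atTop 0)] with p hp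
      have := abs_normalizedCarry_sub_autoregression_le hb hp p.2 t
      rw [autoregression_eq_add] at this
      simp only [Function.comp_apply, Real.dist_eq, recentre]
      rw [abs_sub_comm]
      convert this using 2
      ring
    obtain ⟨V, hV, hVU⟩ := hT hU
    filter_upwards [hV] with n hn d
    exact hVU (a := ⟨n, d⟩) hn
  · change Measure.map _ (digitMeasure b n) = Measure.map _ (Measure.map _ (digitMeasure b n))
    rw [Measure.map_map (measurable_recentre b _) (measurable_normalizedCarry b n)]
    rfl

/-- Translation by the mean of the autoregressive process started at `x`. -/
lemma recentre_neg_recentre (b : ℕ) (x : ℝ) (y : ℕ → ℝ) :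
    recentre b (-x) (recentre b x y) = y := by
  ext t
  simp only [recentre]
  ring

lemma continuous_recentre (b : ℕ) (x : ℝ) : Continuous (recentre b x) :=
  continuous_pi fun t => (continuous_apply t).sub continuous_const

/-- Translations preserve differences, so one entourage serves all of them. -/
lemma uniformEquicontinuous_recentre (b : ℕ) {ι : Type*} (x : ι → ℝ) :
    UniformEquicontinuous fun i => recentre b (x i) := by
  intro U hU
  rw [uniformity_eq_comap_nhds_zero] at hU ⊢
  obtain ⟨V, hV, hVU⟩ := hU
  refine ⟨V, hV, fun p hp i => hVU ?_⟩
  have : recentre b (x i) p.2 - recentre b (x i) p.1 = p.2 - p.1 := by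
    ext t
    simp [recentre]
  simpa only [Set.mem_preimage, this] using hp

lemma map_recentre_autoregressiveLaw (b : ℕ) (x : ℝ) :
    (autoregressiveLaw b x).map (measurable_recentre b x).aemeasurable =
      autoregressiveLaw b 0 := by
  refine Subtype.ext ?_
  change Measure.map _ (Measure.map _ _) = Measure.map _ _
  rw [Measure.map_map (measurable_recentre b x) (measurable_autoregression b x)]
  congr 1
  ext1 ε
  exact recentre_autoregression b x ε

lemma integral_comp_recentre_neg (b : ℕ) (x : ℝ) (μ : ProbabilityMeasure (ℕ → ℝ))
    (F : (ℕ → ℝ) →ᵇ ℝ) :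
    ∫ y, F (recentre b (-x) y) ∂(μ.map (measurable_recentre b x).aemeasurable :
      Measure (ℕ → ℝ)) = ∫ y, F y ∂(μ : Measure (ℕ → ℝ)) := by
  have h : Continuous fun y => F (recentre b (-x) y) :=
    F.continuous.comp (continuous_recentre b _)
  rw [ProbabilityMeasure.toMeasure_map, integral_map (measurable_recentre b x).aemeasurable
    h.measurable.aestronglyMeasurable]
  simp only [recentre_neg_recentre]

end Carries

theorem theorem5p2 (b : ℕ) [NeZero b] (hb : 2 ≤ b) :
    (∀ F : (ℕ → ℝ) →ᵇ ℝ, UniformContinuous F →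
      Tendsto (fun n : ℕ =>
          (∫ y, F y ∂(carriesLaw b n : Measure (ℕ → ℝ))) -
            ∫ w, F w ∂(autoregressiveLaw b (-√(3 * (n : ℝ))) : Measure (ℕ → ℝ)))
        atTop (𝓝 0)) ∧
    Tendsto (fun n : ℕ =>
        (carriesLaw b n).map (f := recentre b (-√(3 * (n : ℝ))))
          (measurable_recentre b (-√(3 * (n : ℝ)))).aemeasurable)
      atTop (𝓝 (autoregressiveLaw b 0)) := by
  have hlim := tendsto_map_recentre_carriesLaw b hb
  refine ⟨fun F hF => ?_, hlim⟩
  -- The test functions are `F` composed with the translation that restores the means `-√(3n) / b ^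
  -- t`. Their integrals against the recentred laws are those of `F` against `P_n` and `Q_n`.
  have h := tendsto_integral_sub_integral_of_uniformEquicontinuous hlim
    (f := fun n => F.compContinuous ⟨_, continuous_recentre b (-(-√(3 * (n : ℝ))))⟩) (C := ‖F‖)
    (fun n => F.norm_compContinuous_le _)
    fun U hU => uniformEquicontinuous_recentre b (fun n : ℕ => -(-√(3 * (n : ℝ)))) _ (hF hU)
  refine h.congr fun n => ?_
  rw [← map_recentre_autoregressiveLaw b (-√(3 * (n : ℝ)))]
  exact congrArg₂ _ (integral_comp_recentre_neg b _ _ F) (integral_comp_recentre_neg b _ _ F)
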